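/- \textbf{Model.} Let $a,b,c,\eta,\rho>0$, $\delta>1$ and let $f$ be a probability density on $(0,\infty)$. Let $y\ge b$ and let $(\Omega,\mathcal F,\mathbb P)$ be a probability space with a complete, right-continuous filtration $\mathbb F=(\mathcal F_t)_{t\ge0}$ such that $\mathcal F_0$ is $\mathbb P$-trivial. Let $N$ be an $\mathbb F$-adapted counting process with $N_0=0$ and unit jumps whose $\mathbb F$-intensity $\lambda$ solves $d\lambda_t=a(b-\lambda_t)\,dt+\eta\,dN_t$, $\lambda_0=y$ (a Hawkes process), and let the claim sizes $Y_1,Y_2,\dots$ be i.i.d. positive random variables with density $f$, independent of $N$. The total claims $\sum_{k\le N_t}Y_k$ are $\mathbb F$-adapted and, given the past, claims with size in a Borel set $B$ arrive at rate $\lambda_t\int_B f(z)\,dz$, that is, $\sum_{k\le N_t}\mathbf 1_B(Y_k)-\int_B f(z)\,dz\int_0^t\lambda_s\,ds$ is an $\mathbb F$-martingale. For $x\in\mathbb R$ put $R^x_t=x+ct-\sum_{k=1}^{N_t}Y_k$. A strategy is a pair $\alpha=(Z,K)$ of nondecreasing $\mathbb F$-adapted processes (cumulative dividends and cumulative capital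 injections), with $Z$ right-continuous, $K$ left-continuous and $Z_{0^-}=K_{0^-}=0$ (hence $K_0=0$). The controlled surplus is $X_t=R^x_t-Z_t+K_t$, with $X_{0^-}=x$. The strategy is admissible from $(x,y)$, written $\alpha\in\mathcal A(x,y)$, if $Z_t-Z_{t^-}\le (X_{t^-}+R^0_t-R^0_{t^-})^+$ for all $t\ge0$. The ruin time is $T^\alpha=\inf\{t\ge0: X_{t^+}<0\}$, the reward is $$J_\alpha(x,y)=\mathbb E\Big[\int_{[0,T^\alpha]}e^{-\rho s}\,dZ_s-\delta\int_{[0,T^\alpha]}e^{-\rho s}\,dK_s\Big]\in[-\infty,\infty),$$ where the jumps at time $0$ and at time $T^\alpha$ are included (no jump at infinity if $T^\alpha=\infty$), and $v(x,y)=\sup_{\alpha\in\mathcal A(x,y)}J_\alpha(x,y)$. \textbf{Proposition (Capital injection threshold).} The value $v(x,y)$ is finite for every $x\in\mathbb R$. Put $\kappa^\star(y)=-v(0,y)/\delta$. Then for every $x<0$: $$v(x,y)=\begin{cases}0 & \text{if } x<\kappa^\star(y),\\ v(0,y)+\delta x & \text{if }\kappa^\star(y)<x<0,\end{cases}\qquad\text{equivalently}\qquad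 v(x,y)=\max\big(v(0,y)+\delta x,\,0\big).$$ Moreover, for every $x<0$: \begin{itemize} \item For each $\alpha'=(Z',K')\in\mathcal A(0,y)$, the strategy $\alpha'_x=(Z',\,K'+|x|\mathbf 1_{(0,\infty)})$, which first injects capital up to $0$ and then follows $\alpha'$, is in $\mathcal A(x,y)$, and $\sup_{\alpha'\in\mathcal A(0,y)}J_{\alpha'_x}(x,y)=v(x,y)$ if and only if $x\ge\kappa^\star(y)$. \item The strategy $(0,0)$, which accepts immediate ruin, is in $\mathcal A(x,y)$, and $J_{(0,0)}(x,y)=v(x,y)$ if and only if $x\le\kappa^\star(y)$. \end{itemize} -/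

import Mathlib

open MeasureTheory ProbabilityTheory Set Filter Topology
open scoped NNReal ENNReal

noncomputable section

/-- The parameters of the model: premium rate `c`, mean-reversion speed `a`, baseline `b` and jump
size `η` of the claim intensity, discount rate `ρ`, cost `δ` of one unit of injected capital, and
the density of the claim sizes, which is carried by `(0, ∞)`. -/
structure RiskParams where
  c : ℝ
  a : ℝ
  b : ℝ
  η : ℝ
  ρ : ℝ
  δ : ℝ
  claimDensity : ℝ → ℝ≥0∞
  c_pos : 0 < c
  a_pos : 0 < a
  b_pos : 0 < b
  η_pos : 0 < η
  ρ_pos : 0 < ρ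
  one_lt_δ : 1 < δ
  measurable_claimDensity : Measurable claimDensity
  lintegral_claimDensity : ∫⁻ z, claimDensity z = 1
  claimDensity_eq_zero : ∀ z, z ≤ 0 → claimDensity z = 0

/-- The law of one claim. -/
def RiskParams.claimLaw (p : RiskParams) : Measure ℝ := volume.withDensity p.claimDensity

/-- The claims process on a filtered probability space, with claim intensity started from `y`. -/
structure HawkesRiskModel (p : RiskParams) (y : ℝ) {Ω : Type*} [mΩ : MeasurableSpace Ω]
    (P : Measure Ω) where
  /-- The information available to the controller. -/
  filt : Filtration ℝ≥0 mΩ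
  filt_rightCont : filt.IsRightContinuous
  filt_complete : ∀ A : Set Ω, P A = 0 → MeasurableSet[filt 0] A
  /-- The initial state is deterministic: the initial sigma-algebra is trivial up to null sets. -/
  filt_zero : ∀ A : Set Ω, MeasurableSet[filt 0] A → P A = 0 ∨ P A = 1
  /-- The number of claims up to time `t`. -/
  N : ℝ≥0 → Ω → ℕ
  N_zero : ∀ ω, N 0 ω = 0
  N_mono : ∀ ω, Monotone (fun t => N t ω)
  N_rightCont : ∀ ω t, ContinuousWithinAt (fun s => N s ω) (Ici t) t
  N_jump : ∀ ω t, N t ω ≤ Function.leftLim (fun s => N s ω) t + 1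
  N_adapted : Adapted filt N
  /-- The claim sizes; the claims up to time `t` are `Y k` with `k < N t`. -/
  Y : ℕ → Ω → ℝ
  Y_measurable : ∀ k, Measurable (Y k)
  Y_pos : ∀ k, ∀ᵐ ω ∂P, 0 < Y k ω
  Y_law : ∀ k, P.map (Y k) = p.claimLaw
  Y_indep : iIndepFun Y P
  Y_indep_N : IndepFun (fun ω k => Y k ω) (fun ω t => N t ω) P
  claims_adapted : Adapted filt (fun t ω => ∑ k ∈ Finset.range (N t ω), Y k ω)
  /-- The claim intensity, the solution of `dλ = a (b - λ) dt + η dN` with `λ₀ = y`. -/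
  intensity : ℝ≥0 → Ω → ℝ
  intensity_eq : ∀ ω t, intensity t ω =
    y + (∫ s in (0 : ℝ)..t, p.a * (p.b - intensity s.toNNReal ω)) + p.η * N t ω
  /-- Given the past, claims with size in `B` arrive at rate `intensity * claimLaw B`; for
  `B = univ` this says that `intensity` is the intensity of `N`. -/
  compensated : ∀ B : Set ℝ, MeasurableSet B →
    Martingale (fun t ω => (∑ k ∈ Finset.range (N t ω), B.indicator (fun _ => (1 : ℝ)) (Y k ω))
      - p.claimLaw.real B * ∫ s in (0 : ℝ)..t, intensity s.toNNReal ω) filt P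

/-- A path on `[0, ∞)`, extended by zero to negative times (its value at time `0-` is zero). -/
def extendPath (g : ℝ≥0 → ℝ) (t : ℝ) : ℝ := if t < 0 then 0 else g t.toNNReal

theorem monotone_extendPath {g : ℝ≥0 → ℝ} (hg : Monotone g) (h0 : 0 ≤ g 0) :
    Monotone (extendPath g) := by
  intro s t hst
  unfold extendPath
  split_ifs with h1 h2 h2
  · exact le_rfl
  · exact h0.trans (hg bot_le)
  · linarith
  · exact hg (Real.toNNReal_mono hst)

/-- The Lebesgue-Stieltjes measure of a nondecreasing path `g` with `g(0-) = 0`. Its mass at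
`t ≥ 0` is the full jump `g(t+) - g(t-)`, whichever one-sided continuity `g` has. -/
def pathMeasure {g : ℝ≥0 → ℝ} (hg : Monotone g) (h0 : 0 ≤ g 0) : Measure ℝ :=
  (monotone_extendPath hg h0).stieltjesFunction.measure

/-- A pair of cumulative dividends `Z` (right-continuous, with `Z(0-) = 0`) and cumulative capital
injections `K` (left-continuous, so that `K(0) = K(0-) = 0`; an injection at time `t` is the jump
`K(t+) - K(t)`). Nondecreasing paths have one-sided limits. -/
structure Strategy {Ω : Type*} {mΩ : MeasurableSpace Ω} (𝔽 : Filtration ℝ≥0 mΩ) where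
  Z : ℝ≥0 → Ω → ℝ
  K : ℝ≥0 → Ω → ℝ
  Z_adapted : Adapted 𝔽 Z
  K_adapted : Adapted 𝔽 K
  Z_mono : ∀ ω, Monotone (fun t => Z t ω)
  K_mono : ∀ ω, Monotone (fun t => K t ω)
  Z_rightCont : ∀ ω t, ContinuousWithinAt (fun s => Z s ω) (Ici t) t
  K_leftCont : ∀ ω t, ContinuousWithinAt (fun s => K s ω) (Iic t) t
  Z_zero : ∀ ω, 0 ≤ Z 0 ω
  K_zero : ∀ ω, K 0 ω = 0

namespace Strategy

variable {Ω : Type*} {mΩ : MeasurableSpace Ω} {𝔽 : Filtration ℝ≥0 mΩ}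

/-- The dividends paid strictly before time `t`. -/
def Zpre (α : Strategy 𝔽) (t : ℝ≥0) (ω : Ω) : ℝ :=
  if t = 0 then 0 else Function.leftLim (fun s => α.Z s ω) t

/-- The random measure `dZ`. -/
def dZ (α : Strategy 𝔽) (ω : Ω) : Measure ℝ := pathMeasure (α.Z_mono ω) (α.Z_zero ω)

/-- The random measure `dK`. -/
def dK (α : Strategy 𝔽) (ω : Ω) : Measure ℝ := pathMeasure (α.K_mono ω) (α.K_zero ω).ge

/-- Neither dividends nor injections. -/
def null (𝔽 : Filtration ℝ≥0 mΩ) : Strategy 𝔽 where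
  Z _ _ := 0
  K _ _ := 0
  Z_adapted _ := measurable_const
  K_adapted _ := measurable_const
  Z_mono _ := monotone_const
  K_mono _ := monotone_const
  Z_rightCont _ _ := continuousWithinAt_const
  K_leftCont _ _ := continuousWithinAt_const
  Z_zero _ := le_rfl
  K_zero _ := rfl

/-- Inject the amount `k` at time `0`, on top of what `α` prescribes. -/
def injectFirst (α : Strategy 𝔽) (k : ℝ≥0) : Strategy 𝔽 where
  Z := α.Z
  K t ω := α.K t ω + if t = 0 then 0 else (k : ℝ)
  Z_adapted := α.Z_adapted
  K_adapted t := (α.K_adapted t).add_const _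
  Z_mono := α.Z_mono
  K_mono ω s t hst := by
    have h := α.K_mono ω hst
    have hk := k.coe_nonneg
    dsimp only at h ⊢
    split_ifs with h1 h2 h2
    · linarith
    · linarith
    · exact absurd (le_antisymm (hst.trans h2.le) bot_le) h1
    · linarith
  Z_rightCont := α.Z_rightCont
  K_leftCont ω t := by
    rcases eq_or_ne t 0 with rfl | ht
    · have : Iic (0 : ℝ≥0) = {0} := by ext s; simp
      rw [this]
      exact continuousWithinAt_singleton
    · refine (α.K_leftCont ω t).add (ContinuousAt.continuousWithinAt ?_)
      refine (continuousAt_const (y := (k : ℝ))).congr ?_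
      filter_upwards [isOpen_ne.mem_nhds ht] with s hs
      exact (if_neg hs).symm
  Z_zero := α.Z_zero
  K_zero ω := by simp [α.K_zero ω]

end Strategy

namespace HawkesRiskModel

variable {p : RiskParams} {y : ℝ} {Ω : Type*} [mΩ : MeasurableSpace Ω] {P : Measure Ω}

/-- The uncontrolled surplus `R^x_t = x + c t - ∑_{k ≤ N_t} Y_k`. -/
def R (M : HawkesRiskModel p y P) (x : ℝ) (t : ℝ≥0) (ω : Ω) : ℝ :=
  x + p.c * t - ∑ k ∈ Finset.range (M.N t ω), M.Y k ω

/-- The controlled surplus `X = R^x - Z + K`. -/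
def X (M : HawkesRiskModel p y P) (x : ℝ) (α : Strategy M.filt) (t : ℝ≥0) (ω : Ω) : ℝ :=
  M.R x t ω - α.Z t ω + α.K t ω

/-- The admissible strategies from `(x, y)`: a dividend paid at time `t` never exceeds the positive
part of `X_{t-} + R_t - R_{t-}`, the reserve after a possible claim at time `t` and before that
dividend. As `X_{t-} = R^x_{t-} - Z_{t-} + K_t` by left-continuity of `K`, this reserve is
`R^x_t - Z_{t-} + K_t`. -/
def admissible (M : HawkesRiskModel p y P) (x : ℝ) : Set (Strategy M.filt) :=
  {α | ∀ ω t, α.Z t ω - α.Zpre t ω ≤ max (M.R x t ω - α.Zpre t ω + α.K t ω) 0}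

/-- The time of ruin `inf {t ≥ 0 : X_{t+} < 0}` (infinite if there is no ruin). -/
def ruinTime (M : HawkesRiskModel p y P) (x : ℝ) (α : Strategy M.filt) (ω : Ω) : ℝ≥0∞ :=
  ⨅ (t : ℝ≥0) (_ : Function.rightLim (fun s => M.X x α s ω) t < 0), (t : ℝ≥0∞)

/-- The interval `[0, T]` of times up to ruin. -/
def aliveTimes (M : HawkesRiskModel p y P) (x : ℝ) (α : Strategy M.filt) (ω : Ω) : Set ℝ :=
  {s | 0 ≤ s ∧ ENNReal.ofReal s ≤ M.ruinTime x α ω}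

/-- The discounted dividends up to ruin. -/
def discDividends (M : HawkesRiskModel p y P) (x : ℝ) (α : Strategy M.filt) (ω : Ω) : ℝ≥0∞ :=
  ∫⁻ s in M.aliveTimes x α ω, ENNReal.ofReal (Real.exp (-p.ρ * s)) ∂(α.dZ ω)

/-- The discounted injections up to ruin. -/
def discInjections (M : HawkesRiskModel p y P) (x : ℝ) (α : Strategy M.filt) (ω : Ω) : ℝ≥0∞ :=
  ∫⁻ s in M.aliveTimes x α ω, ENNReal.ofReal (Real.exp (-p.ρ * s)) ∂(α.dK ω)

/-- The reward `E[∫₀ᵀ e^{-ρs} dZ_s - δ ∫₀ᵀ e^{-ρs} dK_s]`. Both integrals are nonnegative; since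
`δ > 1` and dividends are paid out of the reserve, the expectation exists in `[-∞, ∞)` for every
admissible strategy, and it is `-∞` when the injections have infinite expectation, in agreement
with `⊤ - ⊤ = ⊥` in `EReal`. -/
def J (M : HawkesRiskModel p y P) (x : ℝ) (α : Strategy M.filt) : EReal :=
  ((∫⁻ ω, M.discDividends x α ω ∂P : ℝ≥0∞) : EReal)
    - (p.δ : EReal) * ((∫⁻ ω, M.discInjections x α ω ∂P : ℝ≥0∞) : EReal)

/-- The supremum of the rewards over the admissible strategies, as an extended real. -/
def rewardSup (M : HawkesRiskModel p y P) (x : ℝ) : EReal := ⨆ α ∈ M.admissible x, M.J x α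

/-- The value function `v(x, y)`, `y` being the initial intensity of the model. -/
def v (M : HawkesRiskModel p y P) (x : ℝ) : ℝ := (M.rewardSup x).toReal

/-- The capital injection threshold `κ*(y) = -v(0, y) / δ`. -/
def kappaStar (M : HawkesRiskModel p y P) : ℝ := -M.v 0 / p.δ

end HawkesRiskModel

end

/-!
The value function is finite for a pathwise reason. Up to the time of ruin, dividends are paid out of
the reserve, so that `Z t ≤ x⁺ + c t + K (t+)` (`HawkesRiskModel.Z_le_of_le_ruinTime`); the claims
only enter through their sign. Discounting this inequality bounds the discounted dividends by
`x⁺ + c / ρ` plus the discounted injections, and as an injected unit costs `δ > 1`, no reward exceeds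
`x⁺ + c / ρ` (`HawkesRiskModel.J_le`). All bounds are between lower integrals and constants, so no
measurability of the discounted payments in `ω` is needed.

For `x < 0`, prefixing a strategy from `0` with an injection of `|x|` leaves the surplus after time `0`
and the time of ruin unchanged and lowers the reward by `δ |x|` (`HawkesRiskModel.J_injectFirst`).
Conversely, let `α` be admissible from `x`. The event `{K(0+) < |x|}` belongs to the initial
sigma-algebra, by right-continuity of the filtration, hence has probability `0` or `1`. If it has
probability `1`, ruin is immediate and no dividend is ever counted. If it has probability `0`, then
`α` almost surely agrees with a strategy from `0` prefixed with an injection of `|x|`, namely with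
`Strategy.withdrawFirst` applied to `α` (`HawkesRiskModel.J_le_of_neg`). Therefore
`v x = max (v 0 + δ x) 0`, and the two terms are the values of the two candidate strategies.
-/

/-! ### Stieltjes measures of nondecreasing paths -/

theorem tendsto_toNNReal_nhdsGT (t : ℝ≥0) :
    Tendsto Real.toNNReal (𝓝[>] (t : ℝ)) (𝓝[>] t) := by
  refine tendsto_nhdsWithin_iff.2 ⟨?_, ?_⟩
  · have h : Tendsto Real.toNNReal (𝓝 (t : ℝ)) (𝓝 (t : ℝ).toNNReal) :=
      continuous_real_toNNReal.tendsto _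
    rw [Real.toNNReal_coe] at h
    exact h.mono_left nhdsWithin_le_nhds
  · filter_upwards [self_mem_nhdsWithin] with s hs
    exact Real.lt_toNNReal_iff_coe_lt.2 hs

theorem rightLim_extendPath {g : ℝ≥0 → ℝ} (hg : Monotone g) (t : ℝ≥0) :
    Function.rightLim (extendPath g) t = Function.rightLim g t := by
  refine rightLim_eq_of_tendsto
    (((hg.tendsto_rightLim t).comp (tendsto_toNNReal_nhdsGT t)).congr' ?_)
  filter_upwards [self_mem_nhdsWithin] with s hs
  exact (if_neg (not_lt.2 (t.coe_nonneg.trans hs.le))).symm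

theorem rightLim_extendPath_of_neg (g : ℝ≥0 → ℝ) {t : ℝ} (ht : t < 0) :
    Function.rightLim (extendPath g) t = 0 := by
  refine rightLim_eq_of_tendsto (tendsto_const_nhds.congr' ?_)
  filter_upwards [nhdsWithin_le_nhds (Iio_mem_nhds ht)] with s hs
  exact (if_pos hs).symm

theorem pathMeasure_Icc_zero {g : ℝ≥0 → ℝ} (hg : Monotone g) (h0 : 0 ≤ g 0) (t : ℝ≥0) :
    pathMeasure hg h0 (Icc 0 t) = ENNReal.ofReal (Function.rightLim g t) := by
  have hl : Function.leftLim (monotone_extendPath hg h0).stieltjesFunction 0 = 0 := by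
    refine leftLim_eq_of_tendsto (tendsto_const_nhds.congr' ?_)
    filter_upwards [self_mem_nhdsWithin] with s hs
    rw [Monotone.stieltjesFunction_eq, rightLim_extendPath_of_neg g hs]
  rw [pathMeasure, StieltjesFunction.measure_Icc, hl, Monotone.stieltjesFunction_eq,
    rightLim_extendPath hg, sub_zero]

theorem pathMeasure_congr {g g' : ℝ≥0 → ℝ} (hg : Monotone g) (h0 : 0 ≤ g 0)
    (hg' : Monotone g') (h0' : 0 ≤ g' 0) (h : g = g') :
    pathMeasure hg h0 = pathMeasure hg' h0' := by
  subst h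
  rfl

theorem rightLim_add_step {g g' : ℝ≥0 → ℝ} (hg : Monotone g) {k : ℝ}
    (h : ∀ t, g' t = g t + if t = 0 then 0 else k) (t : ℝ≥0) :
    Function.rightLim g' t = Function.rightLim g t + k := by
  refine rightLim_eq_of_tendsto
    (((hg.tendsto_rightLim t).add_const k).congr' ?_)
  filter_upwards [self_mem_nhdsWithin] with s hs
  rw [h s, if_neg (pos_of_gt hs).ne']

/-- A step just after time `0` adds an atom at `0`: the mass of the measure at `0` is the full jump
from `g(0-) = 0` to `g(0+)`. -/
theorem pathMeasure_add_step {g g' : ℝ≥0 → ℝ} (hg : Monotone g) (h0 : 0 ≤ g 0)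
    (hg' : Monotone g') (h0' : 0 ≤ g' 0) {k : ℝ≥0}
    (h : ∀ t, g' t = g t + if t = 0 then 0 else (k : ℝ)) :
    pathMeasure hg' h0' = pathMeasure hg h0 + (k : ℝ≥0∞) • Measure.dirac 0 := by
  have key : ∀ t : ℝ, Function.rightLim (extendPath g') t =
      Function.rightLim (extendPath g) t + if t < 0 then 0 else (k : ℝ) := by
    intro t
    split_ifs with ht
    · rw [rightLim_extendPath_of_neg g ht, rightLim_extendPath_of_neg g' ht, add_zero]
    · lift t to ℝ≥0 using not_lt.1 ht
      rw [rightLim_extendPath hg, rightLim_extendPath hg', rightLim_add_step hg h]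
  refine Measure.ext_of_Ioc' _ _ (fun a b _ => ?_) fun a b hab => ?_
  · rw [pathMeasure, StieltjesFunction.measure_Ioc]
    exact ENNReal.ofReal_ne_top
  · have hm := (monotone_extendPath hg h0).rightLim hab.le
    simp only [pathMeasure, Measure.add_apply, Measure.smul_apply, StieltjesFunction.measure_Ioc,
      Monotone.stieltjesFunction_eq, key, Measure.dirac_apply, smul_eq_mul, indicator, mem_Ioc,
      Pi.one_apply]
    rcases lt_or_ge a 0 with ha | ha
    · rcases lt_or_ge b 0 with hb | hb
      · simp [ha, hb, hb.not_ge]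
      · rw [if_pos ha, if_neg (not_lt.2 hb), if_pos ⟨ha, hb⟩, mul_one,
          ← ENNReal.ofReal_coe_nnreal (p := k), ← ENNReal.ofReal_add (by linarith) k.coe_nonneg]
        congr 1
        ring
    · rw [if_neg (not_lt.2 ha), if_neg (not_lt.2 (ha.trans hab.le)),
        if_neg (fun h => absurd h.1 (not_lt.2 ha)), mul_zero, add_zero]
      congr 1
      ring

/-! ### Comparison of discounted integrals -/

/-- Comparing two measures on the half-lines `(-∞, u]` compares their integrals of a decreasing
exponential, because its superlevel sets are such half-lines. This takes the place of an integration
by parts. -/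
theorem lintegral_exp_le_of_forall_Iic {μ ν : Measure ℝ} {r : ℝ} (hr : 0 < r)
    (h : ∀ u, μ (Iic u) ≤ ν (Iic u)) :
    ∫⁻ s, ENNReal.ofReal (Real.exp (-r * s)) ∂μ ≤ ∫⁻ s, ENNReal.ofReal (Real.exp (-r * s)) ∂ν := by
  have hm : Measurable fun s : ℝ => Real.exp (-r * s) := by fun_prop
  rw [lintegral_eq_lintegral_meas_le μ (ae_of_all _ fun s => (Real.exp_pos _).le) hm.aemeasurable,
    lintegral_eq_lintegral_meas_le ν (ae_of_all _ fun s => (Real.exp_pos _).le) hm.aemeasurable]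
  refine setLIntegral_mono' measurableSet_Ioi fun t ht => ?_
  have hs : {s : ℝ | t ≤ Real.exp (-r * s)} = Iic (-Real.log t / r) := by
    ext s
    rw [mem_ofPred_eq, mem_Iic, ← Real.log_le_iff_le_exp ht, le_div_iff₀ hr]
    constructor <;> intro h <;> linarith
  rw [hs]
  exact h _

theorem lintegral_exp_Ici_zero {r : ℝ} (hr : 0 < r) :
    ∫⁻ s in Ici 0, ENNReal.ofReal (Real.exp (-r * s)) = ENNReal.ofReal (1 / r) := by
  have hr' : -r < 0 := by linarith
  rw [setLIntegral_congr Ioi_ae_eq_Ici.symm, ← ofReal_integral_eq_lintegral_ofReal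
    (integrableOn_exp_mul_Ioi hr' 0) (ae_of_all _ fun s => (Real.exp_pos _).le),
    integral_exp_mul_Ioi hr']
  simp

/-! ### Extended-real arithmetic of the reward -/

theorem EReal.coe_ennreal_sub_mul_le {A B : ℝ≥0∞} {C d : ℝ} (hC : 0 ≤ C) (hd : 1 ≤ d)
    (h : A ≤ ENNReal.ofReal C + B) : (A : EReal) - (d : EReal) * (B : EReal) ≤ (C : EReal) := by
  rcases eq_or_ne B ⊤ with rfl | hB
  · rw [EReal.coe_ennreal_top, EReal.coe_mul_top_of_pos (by linarith), sub_eq_add_neg,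
      EReal.neg_top, EReal.add_bot]
    exact bot_le
  · have hA : A ≠ ⊤ := (h.trans_lt (by simp [hB.lt_top])).ne
    lift A to ℝ≥0 using hA
    lift B to ℝ≥0 using hB
    have h' : (A : ℝ) ≤ C + B := by
      have := ENNReal.toReal_mono (by simp) h
      rwa [ENNReal.toReal_add (by simp) (by simp), ENNReal.toReal_ofReal hC,
        ENNReal.coe_toReal, ENNReal.coe_toReal] at this
    have hB : (B : ℝ) ≤ d * B := le_mul_of_one_le_left B.coe_nonneg hd
    change ((A : ℝ) : EReal) - (d : EReal) * ((B : ℝ) : EReal) ≤ C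
    exact_mod_cast (by linarith : (A : ℝ) - d * B ≤ C)

theorem EReal.coe_ennreal_sub_mul_add (A B : ℝ≥0∞) (k : ℝ≥0) {d : ℝ} (hd : 0 < d) :
    (A : EReal) - (d : EReal) * ((B + k : ℝ≥0∞) : EReal) =
      ((A : EReal) - (d : EReal) * (B : EReal)) - ((d * k : ℝ) : EReal) := by
  rcases eq_or_ne B ⊤ with rfl | hB
  · rw [top_add, EReal.coe_ennreal_top, EReal.coe_mul_top_of_pos hd, sub_eq_add_neg,
      EReal.neg_top, EReal.add_bot, EReal.bot_sub]
  · lift B to ℝ≥0 using hB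
    rcases eq_or_ne A ⊤ with rfl | hA
    · rw [EReal.coe_ennreal_top]
      change ⊤ - (d : EReal) * (((B + k : ℝ≥0) : ℝ) : EReal) =
        ⊤ - (d : EReal) * ((B : ℝ) : EReal) - _
      rw [← EReal.coe_mul, ← EReal.coe_mul, EReal.top_sub_coe, EReal.top_sub_coe,
        EReal.top_sub_coe]
    · lift A to ℝ≥0 using hA
      change ((A : ℝ) : EReal) - (d : EReal) * (((B + k : ℝ≥0) : ℝ) : EReal) =
        ((A : ℝ) : EReal) - (d : EReal) * ((B : ℝ) : EReal) - _
      have : (A : ℝ) - d * ((B + k : ℝ≥0) : ℝ) = A - d * B - d * k := by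
        push_cast
        ring
      exact_mod_cast this

namespace HawkesRiskModel

variable {p : RiskParams} {y : ℝ} {Ω : Type*} [mΩ : MeasurableSpace Ω] {P : Measure Ω}

/-! ### The controlled surplus and the ruin time -/

theorem R_zero (M : HawkesRiskModel p y P) (x : ℝ) (ω : Ω) : M.R x 0 ω = x := by
  simp [R, M.N_zero ω]

theorem R_eq_add (M : HawkesRiskModel p y P) (x : ℝ) (t : ℝ≥0) (ω : Ω) :
    M.R x t ω = M.R 0 t ω + x := by
  simp only [R]
  ring

theorem ae_R_le (M : HawkesRiskModel p y P) (x : ℝ) :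
    ∀ᵐ ω ∂P, ∀ t, M.R x t ω ≤ x + p.c * t := by
  filter_upwards [ae_all_iff.2 M.Y_pos] with ω hω t
  have : 0 ≤ ∑ k ∈ Finset.range (M.N t ω), M.Y k ω := Finset.sum_nonneg fun k _ => (hω k).le
  simp only [R]
  linarith

theorem continuousWithinAt_R (M : HawkesRiskModel p y P) (x : ℝ) (ω : Ω) (t : ℝ≥0) :
    ContinuousWithinAt (fun s => M.R x s ω) (Ici t) t := by
  have h1 : ContinuousWithinAt (fun s => ∑ k ∈ Finset.range (M.N s ω), M.Y k ω) (Ici t) t :=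
    (continuous_of_discreteTopology (f := fun n : ℕ => ∑ k ∈ Finset.range n, M.Y k ω)).continuousAt
      |>.comp_continuousWithinAt (M.N_rightCont ω t)
  have h2 : ContinuousWithinAt (fun s : ℝ≥0 => x + p.c * (s : ℝ)) (Ici t) t := by fun_prop
  exact h2.sub h1

theorem rightLim_X (M : HawkesRiskModel p y P) (x : ℝ) (α : Strategy M.filt) (ω : Ω) (t : ℝ≥0) :
    Function.rightLim (fun s => M.X x α s ω) t =
      M.R x t ω - α.Z t ω + Function.rightLim (fun s => α.K s ω) t :=
  rightLim_eq_of_tendsto <|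
    (((M.continuousWithinAt_R x ω t).mono Ioi_subset_Ici_self).sub
      ((α.Z_rightCont ω t).mono Ioi_subset_Ici_self)).tendsto.add ((α.K_mono ω).tendsto_rightLim t)

theorem ruinTime_le (M : HawkesRiskModel p y P) {x : ℝ} {α : Strategy M.filt} {ω : Ω} {t : ℝ≥0}
    (h : Function.rightLim (fun s => M.X x α s ω) t < 0) : M.ruinTime x α ω ≤ t :=
  iInf₂_le t h

theorem measurableSet_aliveTimes (M : HawkesRiskModel p y P) (x : ℝ) (α : Strategy M.filt)
    (ω : Ω) : MeasurableSet (M.aliveTimes x α ω) :=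
  measurableSet_Ici.inter (measurableSet_le ENNReal.measurable_ofReal measurable_const)

theorem zero_mem_aliveTimes (M : HawkesRiskModel p y P) (x : ℝ) (α : Strategy M.filt)
    (ω : Ω) : (0 : ℝ) ∈ M.aliveTimes x α ω :=
  ⟨le_rfl, by simp⟩

/-- An initial piece of `[0, T]` is again a compact interval `[0, w]`, on which the Stieltjes measures
of the paths are explicit; `T = ∞` needs no separate treatment. -/
theorem Iic_inter_aliveTimes (M : HawkesRiskModel p y P) (x : ℝ) (α : Strategy M.filt) (ω : Ω)
    (u : ℝ) : Iic u ∩ M.aliveTimes x α ω = ∅ ∨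
      ∃ w : ℝ≥0, (w : ℝ≥0∞) ≤ M.ruinTime x α ω ∧ Iic u ∩ M.aliveTimes x α ω = Icc 0 (w : ℝ) := by
  rcases lt_or_ge u 0 with hu | hu
  · left
    ext s
    simp only [aliveTimes, mem_inter_iff, mem_Iic, mem_ofPred_eq, mem_empty_iff_false, iff_false]
    rintro ⟨h1, h2, -⟩
    linarith
  right
  lift u to ℝ≥0 using hu
  rcases le_or_gt (u : ℝ≥0∞) (M.ruinTime x α ω) with h | h
  · refine ⟨u, h, ?_⟩
    ext s
    constructor
    · exact fun hs => ⟨hs.2.1, hs.1⟩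
    · refine fun hs => ⟨hs.2, hs.1, le_trans ?_ h⟩
      rw [← ENNReal.ofReal_coe_nnreal]
      exact ENNReal.ofReal_le_ofReal hs.2
  · lift M.ruinTime x α ω to ℝ≥0 using h.ne_top with T hT
    refine ⟨T, le_rfl, ?_⟩
    have hTu : (T : ℝ) < u := by exact_mod_cast h
    ext s
    simp only [aliveTimes, mem_inter_iff, mem_Iic, mem_ofPred_eq, ← hT, mem_Icc]
    rw [← ENNReal.ofReal_coe_nnreal, ENNReal.ofReal_le_ofReal_iff T.coe_nonneg]
    constructor
    · exact fun hs => hs.2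
    · exact fun hs => ⟨by linarith, hs⟩

/-! ### Dividends are paid out of the reserve -/

/-- Up to and including the time of ruin, the dividends are covered by the initial reserve, the
premiums and the injections. At the time of ruin this holds because a dividend paid then does not
exceed the positive part of the reserve. -/
theorem Z_le_of_le_ruinTime (M : HawkesRiskModel p y P) {x : ℝ} {α : Strategy M.filt}
    (hα : α ∈ M.admissible x) {ω : Ω} (hR : ∀ t, M.R x t ω ≤ x + p.c * t) {t : ℝ≥0}
    (ht : (t : ℝ≥0∞) ≤ M.ruinTime x α ω) :
    α.Z t ω ≤ max x 0 + p.c * t + Function.rightLim (fun s => α.K s ω) t := by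
  have hx := le_max_left x 0
  have hx0 := le_max_right x 0
  have hRt := hR t
  have hKt : α.K t ω ≤ Function.rightLim (fun s => α.K s ω) t := (α.K_mono ω).le_rightLim le_rfl
  have hK0 : 0 ≤ α.K t ω := (α.K_zero ω).symm.le.trans (α.K_mono ω (bot_le : (0 : ℝ≥0) ≤ t))
  have hct : 0 ≤ p.c * t := mul_nonneg p.c_pos.le t.coe_nonneg
  have hpre : α.Zpre t ω ≤ max x 0 + p.c * t + α.K t ω := by
    unfold Strategy.Zpre
    split_ifs with h0
    · linarith
    · have : (𝓝[<] t).NeBot := nhdsLT_neBot_of_exists_lt ⟨0, pos_iff_ne_zero.2 h0⟩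
      refine le_of_tendsto ((α.Z_mono ω).tendsto_leftLim t) ?_
      filter_upwards [self_mem_nhdsWithin] with s hs
      have hs' : s < t := hs
      have hX : 0 ≤ Function.rightLim (fun s => M.X x α s ω) s := by
        by_contra! hneg
        have := ht.trans (M.ruinTime_le hneg)
        exact absurd (ENNReal.coe_le_coe.1 this) (not_le.2 hs')
      rw [rightLim_X] at hX
      have hKs : Function.rightLim (fun s => α.K s ω) s ≤ α.K t ω :=
        (α.K_mono ω).rightLim_le hs'
      have hcs : p.c * s ≤ p.c * t := mul_le_mul_of_nonneg_left hs'.le p.c_pos.le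
      have := hR s
      linarith
  have hadm := hα ω t
  rcases max_cases (M.R x t ω - α.Zpre t ω + α.K t ω) 0 with ⟨h, -⟩ | ⟨h, -⟩ <;> rw [h] at hadm <;>
    linarith

/-- The pathwise comparison of dividends and injections, from which the value function is finite. -/
theorem discDividends_le (M : HawkesRiskModel p y P) {x : ℝ} {α : Strategy M.filt}
    (hα : α ∈ M.admissible x) {ω : Ω} (hR : ∀ t, M.R x t ω ≤ x + p.c * t) :
    M.discDividends x α ω ≤ ENNReal.ofReal (max x 0 + p.c / p.ρ) + M.discInjections x α ω := by
  have hx0 := le_max_right x 0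
  set S := M.aliveTimes x α ω with hS
  have hSm : MeasurableSet S := M.measurableSet_aliveTimes x α ω
  -- The initial reserve counts as an atom at `0`, the premiums as a multiple of Lebesgue measure.
  set ν : Measure ℝ := (ENNReal.ofReal (max x 0) • Measure.dirac 0 +
    ENNReal.ofReal p.c • volume) + α.dK ω with hν
  have h1 : M.discDividends x α ω ≤ ∫⁻ s in S, ENNReal.ofReal (Real.exp (-p.ρ * s)) ∂ν := by
    refine lintegral_exp_le_of_forall_Iic p.ρ_pos fun u => ?_
    rw [Measure.restrict_apply measurableSet_Iic, Measure.restrict_apply measurableSet_Iic]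
    rcases M.Iic_inter_aliveTimes x α ω u with h | ⟨w, hw, h⟩
    · rw [← hS] at h
      simp [← hS, h]
    · rw [← hS] at h
      have hZ : Function.rightLim (fun s => α.Z s ω) w = α.Z w ω :=
        (α.Z_rightCont ω w).rightLim_eq
      have hK0 : 0 ≤ Function.rightLim (fun s => α.K s ω) w :=
        (α.K_zero ω).symm.le.trans ((α.K_mono ω).le_rightLim bot_le)
      have hcw : 0 ≤ p.c * w := mul_nonneg p.c_pos.le w.coe_nonneg
      rw [h, Strategy.dZ, pathMeasure_Icc_zero, hZ, hν, Measure.add_apply, Measure.add_apply,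
        Measure.smul_apply, Measure.smul_apply, Strategy.dK, pathMeasure_Icc_zero,
        Measure.dirac_apply' _ measurableSet_Icc, Real.volume_Icc, indicator_of_mem (by simp),
        smul_eq_mul, smul_eq_mul, Pi.one_apply, mul_one, sub_zero, ← ENNReal.ofReal_mul p.c_pos.le,
        ← ENNReal.ofReal_add hx0 hcw, ← ENNReal.ofReal_add (by linarith) hK0]
      exact ENNReal.ofReal_le_ofReal (M.Z_le_of_le_ruinTime hα hR hw)
  refine h1.trans ?_
  rw [hν, Measure.restrict_add, Measure.restrict_add, lintegral_add_measure, lintegral_add_measure,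
    Measure.restrict_smul, Measure.restrict_smul, lintegral_smul_measure, lintegral_smul_measure,
    ENNReal.ofReal_add hx0 (div_pos p.c_pos p.ρ_pos).le]
  refine add_le_add (add_le_add ?_ ?_) le_rfl
  · calc ENNReal.ofReal (max x 0) *
        ∫⁻ s in S, ENNReal.ofReal (Real.exp (-p.ρ * s)) ∂Measure.dirac 0
        ≤ ENNReal.ofReal (max x 0) *
          ∫⁻ s, ENNReal.ofReal (Real.exp (-p.ρ * s)) ∂Measure.dirac 0 := by
          gcongr
          exact Measure.restrict_le_self
      _ = ENNReal.ofReal (max x 0) := by simp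
  · calc ENNReal.ofReal p.c * ∫⁻ s in S, ENNReal.ofReal (Real.exp (-p.ρ * s))
        ≤ ENNReal.ofReal p.c * ∫⁻ s in Ici 0, ENNReal.ofReal (Real.exp (-p.ρ * s)) := by
          gcongr
          exact fun s hs => hs.1
      _ = ENNReal.ofReal (p.c / p.ρ) := by
          rw [lintegral_exp_Ici_zero p.ρ_pos, ← ENNReal.ofReal_mul p.c_pos.le, mul_one_div]

/-! ### Finiteness of the value function -/

theorem J_le (M : HawkesRiskModel p y P) [IsProbabilityMeasure P] {x : ℝ} {α : Strategy M.filt}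
    (hα : α ∈ M.admissible x) : M.J x α ≤ ((max x 0 + p.c / p.ρ : ℝ) : EReal) := by
  refine EReal.coe_ennreal_sub_mul_le
    (add_nonneg (le_max_right _ _) (div_pos p.c_pos p.ρ_pos).le) p.one_lt_δ.le ?_
  calc ∫⁻ ω, M.discDividends x α ω ∂P
      ≤ ∫⁻ ω, (ENNReal.ofReal (max x 0 + p.c / p.ρ) + M.discInjections x α ω) ∂P :=
        lintegral_mono_ae ((M.ae_R_le x).mono fun ω hR => M.discDividends_le hα hR)
    _ = _ := by rw [lintegral_add_left measurable_const, lintegral_const, measure_univ, mul_one]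

theorem null_mem_admissible (M : HawkesRiskModel p y P) (x : ℝ) :
    Strategy.null M.filt ∈ M.admissible x := by
  intro ω t
  have h : (Strategy.null M.filt).Zpre t ω = 0 := by
    simp [Strategy.Zpre, Strategy.null, continuous_const.continuousWithinAt.leftLim_eq]
  rw [h]
  exact (sub_zero (0 : ℝ)).le.trans (le_max_right _ _)

theorem discDividends_eq_zero (M : HawkesRiskModel p y P) {x : ℝ} {α : Strategy M.filt}
    {ω : Ω} (h : ∀ w : ℝ≥0, (w : ℝ≥0∞) ≤ M.ruinTime x α ω → α.Z w ω ≤ 0) :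
    M.discDividends x α ω = 0 := by
  refine le_antisymm ?_ bot_le
  have h1 : M.discDividends x α ω ≤ ∫⁻ s, ENNReal.ofReal (Real.exp (-p.ρ * s)) ∂(0 : Measure ℝ) := by
    refine lintegral_exp_le_of_forall_Iic p.ρ_pos fun u => ?_
    rw [Measure.restrict_apply measurableSet_Iic]
    rcases M.Iic_inter_aliveTimes x α ω u with hI | ⟨w, hw, hI⟩
    · simp [hI]
    · rw [hI, Strategy.dZ, pathMeasure_Icc_zero, (α.Z_rightCont ω w).rightLim_eq,
        ENNReal.ofReal_of_nonpos (h w hw)]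
      exact bot_le
  simpa using h1

theorem J_null (M : HawkesRiskModel p y P) (x : ℝ) : M.J x (Strategy.null M.filt) = 0 := by
  have hZ : ∀ ω, M.discDividends x (Strategy.null M.filt) ω = 0 := fun ω =>
    M.discDividends_eq_zero fun _ _ => le_rfl
  -- Both components of the null strategy are the zero path, so `hK` is literally `hZ`.
  have hK : ∀ ω, M.discInjections x (Strategy.null M.filt) ω = 0 := hZ
  simp [J, hZ, hK]

theorem le_rewardSup (M : HawkesRiskModel p y P) {x : ℝ} {α : Strategy M.filt}
    (hα : α ∈ M.admissible x) : M.J x α ≤ M.rewardSup x :=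
  le_iSup₂_of_le α hα le_rfl

theorem rewardSup_nonneg (M : HawkesRiskModel p y P) (x : ℝ) : 0 ≤ M.rewardSup x :=
  (M.J_null x).symm.le.trans (M.le_rewardSup (M.null_mem_admissible x))

theorem coe_v (M : HawkesRiskModel p y P) [IsProbabilityMeasure P] (x : ℝ) :
    (M.v x : EReal) = M.rewardSup x := by
  refine EReal.coe_toReal (ne_top_of_le_ne_top (EReal.coe_ne_top _)
    (iSup₂_le fun α hα => M.J_le hα)) ?_
  exact (EReal.bot_lt_zero.trans_le (M.rewardSup_nonneg x)).ne'

/-! ### Injecting at time zero -/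

theorem rightLim_X_injectFirst (M : HawkesRiskModel p y P) {x : ℝ} {k : ℝ≥0} (hk : (k : ℝ) = -x)
    (α : Strategy M.filt) (ω : Ω) (t : ℝ≥0) :
    Function.rightLim (fun s => M.X x (α.injectFirst k) s ω) t =
      Function.rightLim (fun s => M.X 0 α s ω) t := by
  have h := rightLim_add_step (α.K_mono ω) (fun t => (rfl : (α.injectFirst k).K t ω = _)) t
  rw [rightLim_X, rightLim_X, h, M.R_eq_add x, hk]
  change M.R 0 t ω + x - α.Z t ω + _ = _
  ring

theorem aliveTimes_injectFirst (M : HawkesRiskModel p y P) {x : ℝ} {k : ℝ≥0} (hk : (k : ℝ) = -x)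
    (α : Strategy M.filt) (ω : Ω) :
    M.aliveTimes x (α.injectFirst k) ω = M.aliveTimes 0 α ω := by
  simp only [aliveTimes, ruinTime, M.rightLim_X_injectFirst hk]

theorem injectFirst_mem_admissible (M : HawkesRiskModel p y P) {x : ℝ} {k : ℝ≥0}
    (hk : (k : ℝ) = -x) {α : Strategy M.filt} (hα : α ∈ M.admissible 0) :
    α.injectFirst k ∈ M.admissible x := by
  intro ω t
  have h := hα ω t
  change α.Z t ω - α.Zpre t ω ≤
    max (M.R x t ω - α.Zpre t ω + (α.K t ω + if t = 0 then 0 else (k : ℝ))) 0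
  split_ifs with ht
  · subst ht
    -- From a reserve of `0`, nothing can be paid at time `0`.
    refine le_max_of_le_right (h.trans_eq ?_)
    simp [M.R_zero, α.K_zero, Strategy.Zpre]
  · rw [M.R_eq_add x, hk]
    convert h using 2
    ring

theorem J_injectFirst (M : HawkesRiskModel p y P) [IsProbabilityMeasure P] {x : ℝ} {k : ℝ≥0}
    (hk : (k : ℝ) = -x) (α : Strategy M.filt) :
    M.J x (α.injectFirst k) = M.J 0 α - ((p.δ * k : ℝ) : EReal) := by
  have hZ : ∀ ω, M.discDividends x (α.injectFirst k) ω = M.discDividends 0 α ω := fun ω => by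
    simp only [discDividends, M.aliveTimes_injectFirst hk]
    rfl
  have hK : ∀ ω, M.discInjections x (α.injectFirst k) ω = k + M.discInjections 0 α ω := fun ω => by
    have hd : (α.injectFirst k).dK ω = α.dK ω + (k : ℝ≥0∞) • Measure.dirac 0 :=
      pathMeasure_add_step _ _ _ _ fun t => rfl
    have h0 : (0 : ℝ) ∈ M.aliveTimes 0 α ω := M.zero_mem_aliveTimes 0 α ω
    have hm := M.measurableSet_aliveTimes 0 α ω
    classical
    rw [discInjections, M.aliveTimes_injectFirst hk, hd, Measure.restrict_add,
      lintegral_add_measure, Measure.restrict_smul, lintegral_smul_measure,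
      setLIntegral_dirac' (by fun_prop) hm, if_pos h0, add_comm]
    simp [discInjections]
  have hI : ∫⁻ ω, M.discInjections x (α.injectFirst k) ω ∂P =
      ∫⁻ ω, M.discInjections 0 α ω ∂P + k := by
    simp only [hK]
    rw [lintegral_add_left measurable_const, lintegral_const, measure_univ, mul_one, add_comm]
  simp only [J, hZ, hI]
  exact EReal.coe_ennreal_sub_mul_add _ _ k (by linarith [p.one_lt_δ])

theorem J_congr_ae (M : HawkesRiskModel p y P) (x : ℝ) {α β : Strategy M.filt}
    (hZ : ∀ᵐ ω ∂P, ∀ t, α.Z t ω = β.Z t ω) (hK : ∀ᵐ ω ∂P, ∀ t, α.K t ω = β.K t ω) :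
    M.J x α = M.J x β := by
  have h : ∀ᵐ ω ∂P, M.discDividends x α ω = M.discDividends x β ω ∧
      M.discInjections x α ω = M.discInjections x β ω := by
    filter_upwards [hZ, hK] with ω hz hk
    have hdZ : α.dZ ω = β.dZ ω := pathMeasure_congr _ _ _ _ (funext hz)
    have hdK : α.dK ω = β.dK ω := pathMeasure_congr _ _ _ _ (funext hk)
    have hA : M.aliveTimes x α ω = M.aliveTimes x β ω := by
      simp only [aliveTimes, ruinTime, X, hz, hk]
    simp only [discDividends, discInjections, hdZ, hdK, hA, and_self]
  simp only [J]
  rw [lintegral_congr_ae (h.mono fun ω hω => hω.1), lintegral_congr_ae (h.mono fun ω hω => hω.2)]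

end HawkesRiskModel

/-! ### Strategies from a negative reserve -/

/-- The strategy `α` with an injection of `k` at time `0` removed, on the event `Aᶜ` where `α` makes
such an injection; on `A` nothing is paid or injected, which keeps the paths nondecreasing
everywhere. Off `A`, it is a right inverse of `Strategy.injectFirst`. -/
noncomputable def Strategy.withdrawFirst {Ω : Type*} {mΩ : MeasurableSpace Ω} {𝔽 : Filtration ℝ≥0 mΩ}
    (α : Strategy 𝔽) (k : ℝ≥0) (A : Set Ω) (hA : MeasurableSet[𝔽 0] A)
    (hk : ∀ ω ∉ A, ∀ t, t ≠ 0 → k ≤ α.K t ω) : Strategy 𝔽 where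
  Z t := Aᶜ.indicator (α.Z t)
  K t := Aᶜ.indicator fun ω => if t = 0 then 0 else α.K t ω - k
  Z_adapted t := (α.Z_adapted t).indicator (𝔽.mono bot_le _ hA.compl)
  K_adapted t := by
    refine Measurable.indicator ?_ (𝔽.mono bot_le _ hA.compl)
    split_ifs
    · exact measurable_const
    · exact (α.K_adapted t).sub_const _
  Z_mono ω s t hst := by
    by_cases h : ω ∈ A
    · simp [h]
    · simpa [h] using α.Z_mono ω hst
  K_mono ω s t hst := by
    by_cases h : ω ∈ A
    · simp [h]
    · simp only [indicator_of_mem (mem_compl h)]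
      split_ifs with h1 h2 h2
      · exact le_rfl
      · exact sub_nonneg.2 (hk ω h t h2)
      · exact absurd (le_antisymm (hst.trans h2.le) bot_le) h1
      · exact sub_le_sub_right (α.K_mono ω hst) _
  Z_rightCont ω t := by
    by_cases h : ω ∈ A
    · simpa [h] using continuousWithinAt_const
    · simpa [h] using α.Z_rightCont ω t
  K_leftCont ω t := by
    by_cases h : ω ∈ A
    · simpa [h] using continuousWithinAt_const
    · simp only [indicator_of_mem (mem_compl h)]
      rcases eq_or_ne t 0 with rfl | ht
      · have : Iic (0 : ℝ≥0) = {0} := by ext s; simp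
        rw [this]
        exact continuousWithinAt_singleton
      · refine ((α.K_leftCont ω t).sub continuousWithinAt_const).congr_of_eventuallyEq ?_
          (if_neg ht)
        filter_upwards [nhdsWithin_le_nhds (isOpen_ne.mem_nhds ht)] with s hs
        exact if_neg hs
  Z_zero ω := by
    by_cases h : ω ∈ A
    · simp [h]
    · simpa [h] using α.Z_zero ω
  K_zero ω := by
    by_cases h : ω ∈ A <;> simp [h]

namespace HawkesRiskModel

variable {p : RiskParams} {y : ℝ} {Ω : Type*} [mΩ : MeasurableSpace Ω] {P : Measure Ω}

/-- Right-continuity of the filtration makes `K(0+)` known at time `0`. -/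
theorem measurableSet_exists_K_lt (M : HawkesRiskModel p y P) (α : Strategy M.filt) (k : ℝ) :
    MeasurableSet[M.filt 0] {ω | ∃ t : ℝ≥0, t ≠ 0 ∧ α.K t ω < k} := by
  have := M.filt_rightCont
  refine Filtration.IsRightContinuous.measurableSet ?_
  rw [Filtration.rightCont_eq]
  simp only [MeasurableSpace.measurableSet_iInf]
  intro ε hε
  have hset : {ω | ∃ t : ℝ≥0, t ≠ 0 ∧ α.K t ω < k} =
      ⋃ n : ℕ, {ω | α.K (min ε (1 / ((n : ℝ≥0) + 1))) ω < k} := by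
    ext ω
    simp only [mem_ofPred_eq, mem_iUnion]
    constructor
    · rintro ⟨t, ht, h⟩
      obtain ⟨n, hn⟩ := exists_nat_one_div_lt (pos_iff_ne_zero.2 ht)
      exact ⟨n, (α.K_mono ω ((min_le_right _ _).trans hn.le)).trans_lt h⟩
    · rintro ⟨n, h⟩
      exact ⟨_, (lt_min hε (by positivity)).ne', h⟩
  rw [hset]
  exact MeasurableSet.iUnion fun n =>
    measurableSet_lt (((α.K_adapted _).mono (M.filt.mono (min_le_left _ _)) le_rfl)) measurable_const

theorem Z_zero_of_neg (M : HawkesRiskModel p y P) {x : ℝ} (hx : x < 0) {α : Strategy M.filt}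
    (hα : α ∈ M.admissible x) (ω : Ω) : α.Z 0 ω = 0 := by
  have h := hα ω 0
  have hpre : α.Zpre 0 ω = 0 := if_pos rfl
  rw [hpre, M.R_zero, α.K_zero, sub_zero, sub_zero, add_zero, max_eq_right hx.le] at h
  exact le_antisymm h (α.Z_zero ω)

/-- From a negative reserve, a strategy which does not inject the deficit at once is ruined at time
`0`, before any dividend. -/
theorem discDividends_eq_zero_of_K_lt (M : HawkesRiskModel p y P) {x : ℝ} (hx : x < 0)
    {α : Strategy M.filt} (hα : α ∈ M.admissible x) {ω : Ω} {t : ℝ≥0} (ht : t ≠ 0)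
    (h : α.K t ω < -x) : M.discDividends x α ω = 0 := by
  have h0 := M.Z_zero_of_neg hx hα ω
  have hX : Function.rightLim (fun s => M.X x α s ω) 0 < 0 := by
    have := (α.K_mono ω).rightLim_le (pos_iff_ne_zero.2 ht)
    rw [rightLim_X, M.R_zero, h0]
    linarith
  refine M.discDividends_eq_zero fun w hw => ?_
  have hw0 : w = 0 := by
    have := hw.trans (M.ruinTime_le hX)
    exact le_antisymm (ENNReal.coe_le_coe.1 this) bot_le
  rw [hw0, h0]

theorem withdrawFirst_mem_admissible (M : HawkesRiskModel p y P) {x : ℝ} (hx : x < 0) {k : ℝ≥0}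
    (hkx : (k : ℝ) = -x) {α : Strategy M.filt} (hα : α ∈ M.admissible x) {A : Set Ω}
    (hA : MeasurableSet[M.filt 0] A) (hk : ∀ ω ∉ A, ∀ t, t ≠ 0 → k ≤ α.K t ω) :
    α.withdrawFirst k A hA hk ∈ M.admissible 0 := by
  intro ω t
  by_cases h : ω ∈ A
  · have hZ : ∀ s, (α.withdrawFirst k A hA hk).Z s ω = 0 := fun s => by
      simp [Strategy.withdrawFirst, h]
    have hpre : (α.withdrawFirst k A hA hk).Zpre t ω = 0 := by
      simp [Strategy.Zpre, hZ, continuous_const.continuousWithinAt.leftLim_eq]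
    rw [hZ, hpre, sub_zero]
    exact le_max_right _ _
  · have hZ : ∀ s, (α.withdrawFirst k A hA hk).Z s ω = α.Z s ω := fun s => by
      simp [Strategy.withdrawFirst, h]
    have hpre : (α.withdrawFirst k A hA hk).Zpre t ω = α.Zpre t ω := by
      simp only [Strategy.Zpre, hZ]
    rw [hZ, hpre]
    rcases eq_or_ne t 0 with rfl | ht
    · rw [M.Z_zero_of_neg hx hα, Strategy.Zpre, if_pos rfl, sub_zero]
      exact le_max_right _ _
    · have hK : (α.withdrawFirst k A hA hk).K t ω = α.K t ω - k := by
        simp [Strategy.withdrawFirst, h, ht]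
      have := hα ω t
      rw [M.R_eq_add x] at this
      rw [hK, hkx]
      convert this using 2
      ring

theorem J_le_of_neg (M : HawkesRiskModel p y P) [IsProbabilityMeasure P] {x : ℝ} (hx : x < 0)
    {α : Strategy M.filt} (hα : α ∈ M.admissible x) :
    M.J x α ≤ max ((M.v 0 + p.δ * x : ℝ) : EReal) 0 := by
  set A : Set Ω := {ω | ∃ t : ℝ≥0, t ≠ 0 ∧ α.K t ω < -x} with hAdef
  have hA : MeasurableSet[M.filt 0] A := M.measurableSet_exists_K_lt α (-x)
  -- The initial sigma-algebra is trivial, so `α` almost surely injects the deficit or almost surely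
  -- does not.
  rcases M.filt_zero A hA with h | h
  · obtain ⟨k, hk⟩ : ∃ k : ℝ≥0, (k : ℝ) = -x := ⟨⟨-x, by linarith⟩, rfl⟩
    have hkK : ∀ ω ∉ A, ∀ t, t ≠ 0 → (k : ℝ) ≤ α.K t ω := fun ω hω t ht => by
      by_contra! hlt
      exact hω ⟨t, ht, hk ▸ hlt⟩
    set β := α.withdrawFirst k A hA hkK with hβ
    have hβ0 : β ∈ M.admissible 0 := M.withdrawFirst_mem_admissible hx hk hα hA hkK
    have hae : ∀ᵐ ω ∂P, ω ∉ A := measure_eq_zero_iff_ae_notMem.1 h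
    have hJ : M.J x α = M.J x (β.injectFirst k) := by
      refine M.J_congr_ae x (hae.mono fun ω hω t => ?_) (hae.mono fun ω hω t => ?_)
      · simp [hβ, Strategy.withdrawFirst, Strategy.injectFirst, hω]
      · rcases eq_or_ne t 0 with rfl | ht
        · simp [Strategy.K_zero]
        · simp [hβ, Strategy.withdrawFirst, Strategy.injectFirst, hω, ht]
    refine le_max_of_le_left ?_
    rw [hJ, M.J_injectFirst hk, hk]
    calc M.J 0 β - ((p.δ * -x : ℝ) : EReal) ≤ (M.v 0 : EReal) - ((p.δ * -x : ℝ) : EReal) :=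
          EReal.sub_le_sub ((M.le_rewardSup hβ0).trans_eq (M.coe_v 0).symm) le_rfl
      _ = _ := by
          rw [← EReal.coe_sub]
          congr 1
          ring
  · have hae : ∀ᵐ ω ∂P, ω ∈ A := (prob_compl_eq_zero_iff (M.filt.le 0 _ hA)).2 h
    have hZ : ∫⁻ ω, M.discDividends x α ω ∂P = 0 := by
      rw [lintegral_congr_ae (g := fun _ => 0) (hae.mono fun ω hω => ?_), lintegral_zero]
      obtain ⟨t, ht, hlt⟩ := hω
      exact M.discDividends_eq_zero_of_K_lt hx hα ht hlt
    refine le_max_of_le_right ?_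
    rw [J, hZ]
    exact EReal.coe_ennreal_sub_mul_le (C := 0) le_rfl p.one_lt_δ.le bot_le

theorem iSup_J_injectFirst (M : HawkesRiskModel p y P) [IsProbabilityMeasure P] {x : ℝ} {k : ℝ≥0}
    (hk : (k : ℝ) = -x) :
    ⨆ α ∈ M.admissible 0, M.J x (α.injectFirst k) = ((M.v 0 + p.δ * x : ℝ) : EReal) := by
  have hv : ((M.v 0 + p.δ * x : ℝ) : EReal) = M.rewardSup 0 - ((p.δ * k : ℝ) : EReal) := by
    rw [← M.coe_v 0, ← EReal.coe_sub, hk]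
    congr 1
    ring
  rw [hv]
  simp only [M.J_injectFirst hk]
  refine le_antisymm (iSup₂_le fun α hα => EReal.sub_le_sub (M.le_rewardSup hα) le_rfl) ?_
  refine EReal.sub_le_of_le_add (iSup₂_le fun α hα => ?_)
  rw [← EReal.sub_le_iff_le_add (.inl (EReal.coe_ne_bot _)) (.inl (EReal.coe_ne_top _))]
  exact le_iSup₂_of_le α hα le_rfl

/-- From a negative reserve there is a choice only between restoring the reserve `0` at the unit
price `δ` and accepting ruin. -/
theorem v_of_neg (M : HawkesRiskModel p y P) [IsProbabilityMeasure P] {x : ℝ} (hx : x < 0) :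
    M.v x = max (M.v 0 + p.δ * x) 0 := by
  obtain ⟨k, hk⟩ : ∃ k : ℝ≥0, (k : ℝ) = -x := ⟨⟨-x, by linarith⟩, rfl⟩
  have h : (M.v x : EReal) = max ((M.v 0 + p.δ * x : ℝ) : EReal) ((0 : ℝ) : EReal) := by
    rw [M.coe_v]
    refine le_antisymm (iSup₂_le fun α hα => M.J_le_of_neg hx hα)
      (max_le ?_ (M.rewardSup_nonneg x))
    rw [← M.iSup_J_injectFirst hk]
    exact iSup₂_le fun α hα => M.le_rewardSup (M.injectFirst_mem_admissible hk hα)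
  rw [← EReal.coe_strictMono.monotone.map_max] at h
  exact_mod_cast h

theorem kappaStar_le_iff (M : HawkesRiskModel p y P) (x : ℝ) :
    M.kappaStar ≤ x ↔ 0 ≤ M.v 0 + p.δ * x := by
  rw [kappaStar, div_le_iff₀ (by linarith [p.one_lt_δ])]
  constructor <;> intro h <;> linarith

theorem le_kappaStar_iff (M : HawkesRiskModel p y P) (x : ℝ) :
    x ≤ M.kappaStar ↔ M.v 0 + p.δ * x ≤ 0 := by
  rw [kappaStar, le_div_iff₀ (by linarith [p.one_lt_δ])]
  constructor <;> intro h <;> linarith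

end HawkesRiskModel

/-! ### The capital injection threshold -/

theorem mainTheorem3 (p : RiskParams) (y : ℝ) (hy : p.b ≤ y) {Ω : Type*} [MeasurableSpace Ω]
    (P : Measure Ω) [IsProbabilityMeasure P] (M : HawkesRiskModel p y P) :
    -- the value function is finite
    (∀ x : ℝ, M.rewardSup x = (M.v x : EReal)) ∧
    ∀ x : ℝ, x < 0 →
      (x < M.kappaStar → M.v x = 0) ∧
      (M.kappaStar < x → M.v x = M.v 0 + p.δ * x) ∧
      M.v x = max (M.v 0 + p.δ * x) 0 ∧
      -- injecting up to `0` and going on optimally from there is optimal exactly above the threshold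
      (∀ α ∈ M.admissible 0, α.injectFirst (-x).toNNReal ∈ M.admissible x) ∧
      ((⨆ α ∈ M.admissible 0, M.J x (α.injectFirst (-x).toNNReal)) = (M.v x : EReal) ↔
        M.kappaStar ≤ x) ∧
      -- accepting ruin is optimal exactly below the threshold
      Strategy.null M.filt ∈ M.admissible x ∧
      (M.J x (Strategy.null M.filt) = (M.v x : EReal) ↔ x ≤ M.kappaStar) := by
  refine ⟨fun x => (M.coe_v x).symm, fun x hx => ?_⟩
  have hk : ((-x).toNNReal : ℝ) = -x := Real.coe_toNNReal _ (by linarith)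
  have hv := M.v_of_neg hx
  refine ⟨fun h => ?_, fun h => ?_, hv, fun α hα => M.injectFirst_mem_admissible hk hα, ?_,
    M.null_mem_admissible x, ?_⟩
  · rw [hv, max_eq_right ((M.le_kappaStar_iff x).1 h.le)]
  · rw [hv, max_eq_left ((M.kappaStar_le_iff x).1 h.le)]
  · rw [M.iSup_J_injectFirst hk, EReal.coe_eq_coe_iff, hv, M.kappaStar_le_iff, left_eq_sup]
  · rw [M.J_null, ← EReal.coe_zero, EReal.coe_eq_coe_iff, hv, M.le_kappaStar_iff, right_eq_sup]
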